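/- Let $n\ge 0$ and let $H_1,\dots,H_n$ be complex separable Hilbert spaces (with inner products antilinear in the first variable). Let $H_1\otimes\cdots\otimes H_n$ be their Hilbert space tensor product, i.e. the completion of the algebraic tensor product for the inner product determined by $\langle \phi_1\otimes\cdots\otimes\phi_n,\psi_1\otimes\cdots\otimes\psi_n\rangle=\prod_{j=1}^n\langle\phi_j,\psi_j\rangle$. For bounded operators $A_j\in\mathcal L(H_j)$, let $A_1\otimes\cdots\otimes A_n$ be the closure of the operator which is defined on the algebraic tensor product by linear extension of $\phi_1\otimes\cdots\otimes\phi_n\mapsto A_1\phi_1\otimes\cdots\otimes A_n\phi_n$. For $0<p<\infty$, a compact operator $A$ on a Hilbert space $H$ belongs to the Schatten--von Neumann class $S_p(H)$ if $\sum_k s_k(A)^p<\infty$, where the $s_k(A)$ are the singular values of $A$, i.e. the eigenvalues of $|A|=\sqrt{A^*A}$ counted with multiplicity, and then $\|A\|_{S_p(H)}=\bigl(\sum_k s_k(A)^p\bigr)^{1/p}$. For $A\in S_1(H)$, $\mathrm{Tr}(A)=\sum_k\langle\phi_k,A\phi_k\rangle$, where $(\phi_k)_k$ is an orthonormal basis of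 $H$. (i) If $A_j\in\mathcal L(H_j)$ for $j=1,\dots,n$, then $A_1\otimes\cdots\otimes A_n$ is an everywhere defined bounded operator, $A_1\otimes\cdots\otimes A_n\in\mathcal L(H_1\otimes\cdots\otimes H_n)$, and $$\Bigl\|\bigotimes_{j=1}^n A_j\Bigr\|_{\mathcal L(H_1\otimes\cdots\otimes H_n)}=\prod_{j=1}^n\|A_j\|_{\mathcal L(H_j)}.$$ (ii) Let $0<p<\infty$. If $A_j\in S_p(H_j)$ for $j=1,\dots,n$, then $A_1\otimes\cdots\otimes A_n\in S_p(H_1\otimes\cdots\otimes H_n)$ and $$\Bigl\|\bigotimes_{j=1}^n A_j\Bigr\|_{S_p(H_1\otimes\cdots\otimes H_n)}=\prod_{j=1}^n\|A_j\|_{S_p(H_j)}.$$ If moreover $p=1$, then for each of the operators $A_1,\dots,A_n$ and $\bigotimes_{j=1}^nA_j$ the series defining the trace converges absolutely, with a sum that does not depend on the orthonormal basis, and $$\mathrm{Tr}\Bigl(\bigotimes_{j=1}^n A_j\Bigr)=\prod_{j=1}^n\mathrm{Tr}(A_j).$$ -/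

import Mathlib

open scoped TensorProduct InnerProductSpace ENNReal ComplexOrder

noncomputable section

namespace HilbertTensor

/-! ### The algebraic tensor product of finitely many Hilbert spaces as a pre-Hilbert space -/

section Algebraic

variable {ι : Type*} [Fintype ι] (H : ι → Type*)
  [∀ i, NormedAddCommGroup (H i)] [∀ i, InnerProductSpace ℂ (H i)]

/-- The algebraic tensor product `⨂ᵢ H i` over `ℂ`. It is a separate type because Mathlib puts the
projective seminorm on `⨂[ℂ] i, H i`, while here the norm comes from the inner product. -/
def AlgTensor : Type _ := ⨂[ℂ] i, H i

instance : AddCommGroup (AlgTensor H) := inferInstanceAs (AddCommGroup (⨂[ℂ] i, H i))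

instance : Module ℂ (AlgTensor H) := inferInstanceAs (Module ℂ (⨂[ℂ] i, H i))

variable {H}

/-- The elementary tensor `⨂ᵢ x i`. -/
def AlgTensor.tprod (x : ∀ i, H i) : AlgTensor H := PiTensorProduct.tprod ℂ x

/-- The linear functional on the algebraic tensor product with `⨂ᵢ x i ↦ ∏ᵢ ⟪y i, x i⟫`. -/
def pairing (y : ∀ i, H i) : AlgTensor H →ₗ[ℂ] ℂ :=
  PiTensorProduct.lift ((MultilinearMap.mkPiAlgebra ℂ ι ℂ).compLinearMap fun i => innerₛₗ ℂ (y i))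

lemma pairing_tprod (y x : ∀ i, H i) :
    pairing y (AlgTensor.tprod x) = ∏ i, ⟪y i, x i⟫_ℂ := by
  simp only [pairing, AlgTensor.tprod]
  erw [PiTensorProduct.lift.tprod]
  simp

@[elab_as_elim]
lemma AlgTensor.induction {P : AlgTensor H → Prop} (u : AlgTensor H)
    (h1 : ∀ (c : ℂ) (x : ∀ i, H i), P (c • AlgTensor.tprod x))
    (h2 : ∀ u v, P u → P v → P (u + v)) : P u :=
  PiTensorProduct.induction_on (R := ℂ) (motive := P) u h1 h2

lemma pairing_update_add [DecidableEq ι] (y : ∀ i, H i) (i : ι) (a b : H i) (u : AlgTensor H) :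
    pairing (Function.update y i (a + b)) u
      = pairing (Function.update y i a) u + pairing (Function.update y i b) u := by
  induction u using AlgTensor.induction with
  | h1 c x =>
    have key : ∀ z : H i, ∏ j, ⟪Function.update y i z j, x j⟫_ℂ
        = ⟪z, x i⟫_ℂ * ∏ j ∈ Finset.univ.erase i, ⟪y j, x j⟫_ℂ := by
      intro z
      rw [← Finset.mul_prod_erase _ _ (Finset.mem_univ i), Function.update_self]
      congr 1
      refine Finset.prod_congr rfl fun j hj => ?_
      rw [Function.update_of_ne (Finset.ne_of_mem_erase hj)]
    simp only [map_smul, pairing_tprod, key, inner_add_left, smul_eq_mul]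
    ring
  | h2 u v hu hv => simp only [map_add, hu, hv]; ring

lemma pairing_update_smul [DecidableEq ι] (y : ∀ i, H i) (i : ι) (r : ℂ) (a : H i)
    (u : AlgTensor H) :
    pairing (Function.update y i (r • a)) u
      = (starRingEnd ℂ) r * pairing (Function.update y i a) u := by
  induction u using AlgTensor.induction with
  | h1 c x =>
    have key : ∀ z : H i, ∏ j, ⟪Function.update y i z j, x j⟫_ℂ
        = ⟪z, x i⟫_ℂ * ∏ j ∈ Finset.univ.erase i, ⟪y j, x j⟫_ℂ := by
      intro z
      rw [← Finset.mul_prod_erase _ _ (Finset.mem_univ i), Function.update_self]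
      congr 1
      refine Finset.prod_congr rfl fun j hj => ?_
      rw [Function.update_of_ne (Finset.ne_of_mem_erase hj)]
    simp only [map_smul, pairing_tprod, key, inner_smul_left, smul_eq_mul]
    ring
  | h2 u v hu hv => simp only [map_add, hu, hv]; ring

/-- The linear map `v ↦ (u ↦ ⟪u, v⟫)` into the antilinear functionals. -/
def innerAux : AlgTensor H →ₗ[ℂ] (AlgTensor H →ₗ⋆[ℂ] ℂ) :=
  PiTensorProduct.lift (R := ℂ) (E := AlgTensor H →ₗ⋆[ℂ] ℂ)
    { toFun := fun y =>
        { toFun := fun u => (starRingEnd ℂ) (pairing y u)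
          map_add' := fun u v => by simp
          map_smul' := fun c u => by simp }
      map_update_add' := fun y i a b => by
        ext u; simp [pairing_update_add]
      map_update_smul' := fun y i r a => by
        ext u; simp [pairing_update_smul] }

/-- The inner product of the algebraic tensor product, antilinear in the first variable; see
`inner_tprod` for its value on elementary tensors, which determines it. -/
instance : Inner ℂ (AlgTensor H) := ⟨fun u v => innerAux v u⟩

lemma inner_eq (u v : AlgTensor H) : ⟪u, v⟫_ℂ = innerAux v u := rfl

lemma inner_tprod_right (u : AlgTensor H) (y : ∀ i, H i) :
    ⟪u, AlgTensor.tprod y⟫_ℂ = (starRingEnd ℂ) (pairing y u) := by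
  rw [inner_eq]; simp only [innerAux, AlgTensor.tprod]
  erw [PiTensorProduct.lift.tprod]; rfl

theorem inner_tprod (x y : ∀ i, H i) :
    ⟪AlgTensor.tprod x, AlgTensor.tprod y⟫_ℂ = ∏ i, ⟪x i, y i⟫_ℂ := by
  rw [inner_tprod_right, pairing_tprod, map_prod]
  exact Finset.prod_congr rfl fun i _ => inner_conj_symm _ _

lemma alg_add_left (u v w : AlgTensor H) : ⟪u + v, w⟫_ℂ = ⟪u, w⟫_ℂ + ⟪v, w⟫_ℂ := by
  simp [inner_eq]

lemma alg_add_right (u v w : AlgTensor H) : ⟪u, v + w⟫_ℂ = ⟪u, v⟫_ℂ + ⟪u, w⟫_ℂ := by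
  simp [inner_eq]

lemma alg_smul_left (c : ℂ) (u v : AlgTensor H) :
    ⟪c • u, v⟫_ℂ = (starRingEnd ℂ) c * ⟪u, v⟫_ℂ := by
  simp [inner_eq]

lemma alg_smul_right (c : ℂ) (u v : AlgTensor H) : ⟪u, c • v⟫_ℂ = c * ⟪u, v⟫_ℂ := by
  simp [inner_eq]

lemma inner_tprod_left (y : ∀ i, H i) (u : AlgTensor H) :
    ⟪AlgTensor.tprod y, u⟫_ℂ = pairing y u := by
  induction u using AlgTensor.induction with
  | h1 c x => rw [alg_smul_right, inner_tprod, map_smul, pairing_tprod, smul_eq_mul]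
  | h2 u v hu hv => rw [alg_add_right, hu, hv, map_add]

lemma alg_conj_symm (u v : AlgTensor H) : (starRingEnd ℂ) ⟪v, u⟫_ℂ = ⟪u, v⟫_ℂ := by
  induction v using AlgTensor.induction with
  | h1 c x =>
    rw [alg_smul_left, alg_smul_right, inner_tprod_left, inner_tprod_right]; simp
  | h2 v w hv hw => rw [alg_add_left, alg_add_right, map_add, hv, hw]

lemma exists_sum_tprod (u : AlgTensor H) :
    ∃ (n : ℕ) (c : Fin n → ℂ) (x : Fin n → ∀ i, H i),
      u = ∑ k, c k • AlgTensor.tprod (x k) := by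
  induction u using AlgTensor.induction with
  | h1 c x => exact ⟨1, fun _ => c, fun _ => x, by simp⟩
  | h2 u v hu hv =>
    obtain ⟨n, c, x, rfl⟩ := hu
    obtain ⟨m, d, y, rfl⟩ := hv
    exact ⟨n + m, Fin.append c d, Fin.append x y, by simp [Fin.sum_univ_add]⟩

lemma posSemidef_prod_gram {n : ℕ} (x : Fin n → ∀ i, H i) (s : Finset ι) :
    (Matrix.of fun k l => ∏ i ∈ s, ⟪x k i, x l i⟫_ℂ : Matrix (Fin n) (Fin n) ℂ).PosSemidef := by
  classical
  induction s using Finset.induction_on with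
  | empty =>
    have := Matrix.posSemidef_gram ℂ (fun _ : Fin n => (1 : ℂ))
    have e : (Matrix.of fun k l => ∏ i ∈ (∅ : Finset ι), ⟪x k i, x l i⟫_ℂ :
        Matrix (Fin n) (Fin n) ℂ) = Matrix.gram ℂ (fun _ : Fin n => (1 : ℂ)) := by
      ext k l; simp [Matrix.gram_apply]
    rw [e]; exact this
  | insert a s ha ih =>
    have := (Matrix.posSemidef_gram ℂ (fun k => x k a)).hadamard ih
    have e : (Matrix.of fun k l => ∏ i ∈ insert a s, ⟪x k i, x l i⟫_ℂ :
        Matrix (Fin n) (Fin n) ℂ) = (Matrix.gram ℂ (fun k => x k a)).hadamard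
          (Matrix.of fun k l => ∏ i ∈ s, ⟪x k i, x l i⟫_ℂ) := by
      ext k l; simp [Matrix.gram_apply, Finset.prod_insert ha]
    rw [e]; exact this

lemma alg_sum_left {α : Type*} (s : Finset α) (f : α → AlgTensor H) (v : AlgTensor H) :
    ⟪∑ k ∈ s, f k, v⟫_ℂ = ∑ k ∈ s, ⟪f k, v⟫_ℂ := by
  simp only [inner_eq, map_sum]

lemma alg_sum_right {α : Type*} (s : Finset α) (f : α → AlgTensor H) (v : AlgTensor H) :
    ⟪v, ∑ k ∈ s, f k⟫_ℂ = ∑ k ∈ s, ⟪v, f k⟫_ℂ := by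
  simp only [inner_eq, map_sum, LinearMap.sum_apply]

lemma alg_nonneg (u : AlgTensor H) : 0 ≤ RCLike.re ⟪u, u⟫_ℂ := by
  obtain ⟨n, c, x, rfl⟩ := exists_sum_tprod u
  have h := (posSemidef_prod_gram x Finset.univ).dotProduct_mulVec_nonneg c
  have h2 : ⟪∑ k, c k • AlgTensor.tprod (x k), ∑ k, c k • AlgTensor.tprod (x k)⟫_ℂ
      = star c ⬝ᵥ Matrix.mulVec
          (Matrix.of fun k l => ∏ i, ⟪x k i, x l i⟫_ℂ : Matrix (Fin n) (Fin n) ℂ) c := by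
    simp only [alg_sum_left, alg_sum_right, alg_smul_left, alg_smul_right, inner_tprod, dotProduct,
      Matrix.mulVec, Matrix.of_apply, Pi.star_apply, Finset.mul_sum, RCLike.star_def]
    rw [Finset.sum_comm]
    exact Finset.sum_congr rfl fun k _ => Finset.sum_congr rfl fun l _ => by ring
  rw [h2]
  exact (Complex.le_def.1 h).1

/-- The inner product, before its definiteness is known. -/
@[reducible] def preCore : PreInnerProductSpace.Core ℂ (AlgTensor H) where
  conj_inner_symm := alg_conj_symm
  re_inner_nonneg := alg_nonneg
  add_left := alg_add_left
  smul_left u v c := alg_smul_left c u v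

lemma exists_dual {E : Type*} [NormedAddCommGroup E] [InnerProductSpace ℂ E] {κ : Type*}
    (b : Module.Basis κ ℂ E) (S : Finset κ) (k : κ) :
    ∃ y : E, ∀ l ∈ S, ⟪y, b l⟫_ℂ = b.repr (b l) k := by
  classical
  let V : Submodule ℂ E := Submodule.span ℂ (S.image b : Set E)
  have : FiniteDimensional ℂ V := FiniteDimensional.span_finset ℂ _
  have : CompleteSpace V := FiniteDimensional.complete ℂ V
  let f : V →L[ℂ] ℂ := LinearMap.toContinuousLinearMap (b.coord k ∘ₗ V.subtype)
  refine ⟨((InnerProductSpace.toDual ℂ V).symm f : V), fun l hl => ?_⟩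
  have hm : b l ∈ V := Submodule.subset_span (by simpa using ⟨l, hl, rfl⟩)
  have := InnerProductSpace.toDual_symm_apply (𝕜 := ℂ) (x := (⟨b l, hm⟩ : V)) (y := f)
  rw [Submodule.coe_inner] at this
  simpa [f] using this

lemma alg_definite (u : AlgTensor H) (hu : ⟪u, u⟫_ℂ = 0) : u = 0 := by
  classical
  have hp : ∀ y : ∀ i, H i, pairing y u = 0 := by
    intro y
    rw [← inner_tprod_left]
    have h := @InnerProductSpace.Core.inner_mul_inner_self_le ℂ (AlgTensor H) _ _ _ preCore
      (AlgTensor.tprod y) u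
    have h0 : ‖⟪AlgTensor.tprod y, u⟫_ℂ‖ * ‖⟪u, AlgTensor.tprod y⟫_ℂ‖ ≤ 0 := by
      refine h.trans (le_of_eq ?_)
      change RCLike.re ⟪AlgTensor.tprod y, AlgTensor.tprod y⟫_ℂ * RCLike.re ⟪u, u⟫_ℂ = 0
      rw [hu]; simp
    rw [← alg_conj_symm u, RCLike.norm_conj] at h0
    exact norm_eq_zero.1 (mul_self_eq_zero.1 (le_antisymm h0 (mul_self_nonneg _)))
  let b : ∀ i, Module.Basis _ ℂ (H i) := fun i => Module.Basis.ofVectorSpace ℂ (H i)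
  let B := Basis.piTensorProduct b
  refine B.ext_elem fun k => ?_
  let S : ∀ i, Finset _ := fun i => (B.repr u).support.image fun q => q i
  choose y hy using fun i => exists_dual (b i) (S i) (k i)
  have e : u = ∑ q ∈ (B.repr u).support, (B.repr u) q • AlgTensor.tprod (fun i => b i (q i)) := by
    conv_lhs => rw [← B.linearCombination_repr u]
    rw [Finsupp.linearCombination_apply, Finsupp.sum]
    refine Finset.sum_congr rfl fun q _ => ?_
    rw [Basis.piTensorProduct_apply]; rfl
  have h1 : pairing y u = B.repr u k := by
    conv_lhs => rw [e]
    rw [map_sum]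
    have : ∀ q ∈ (B.repr u).support,
        pairing y ((B.repr u) q • AlgTensor.tprod (fun i => b i (q i)))
          = (B.repr u) q * if q = k then 1 else 0 := by
      intro q hq
      rw [map_smul, pairing_tprod, smul_eq_mul]
      congr 1
      rw [Finset.prod_congr rfl fun i _ => hy i (q i) (Finset.mem_image_of_mem _ hq)]
      simp only [Module.Basis.repr_self, Finsupp.single_apply, Fintype.prod_ite_zero,
        Finset.prod_const_one, ← funext_iff]
    rw [Finset.sum_congr rfl this]
    by_cases hk : k ∈ (B.repr u).support
    · simp [Finset.sum_ite_eq', hk]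
    · simp only [mul_ite, mul_one, mul_zero, Finset.sum_ite_eq', hk, if_false]
      exact (Finsupp.notMem_support_iff.1 hk).symm
  rw [← h1, hp]
  exact (DFunLike.congr_fun (map_zero B.repr) k).symm

@[reducible] def core : InnerProductSpace.Core ℂ (AlgTensor H) :=
  { preCore with definite := alg_definite }

instance : NormedAddCommGroup (AlgTensor H) := core.toNormedAddCommGroup

instance : InnerProductSpace ℂ (AlgTensor H) := InnerProductSpace.ofCore core.toCore

end Algebraic

/-! ### The Hilbert space tensor product and tensor products of bounded operators -/

section Operators

variable {ι : Type*} [Fintype ι] (H : ι → Type*)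
  [∀ i, NormedAddCommGroup (H i)] [∀ i, InnerProductSpace ℂ (H i)]

/-- The tensor product of finitely many Hilbert spaces: the completion of the algebraic one. -/
abbrev HilbertTensorProduct : Type _ := UniformSpace.Completion (AlgTensor H)

variable {H}

/-- The algebraic tensor product, embedded in its completion. -/
def algSubspace (H : ι → Type*) [∀ i, NormedAddCommGroup (H i)]
    [∀ i, InnerProductSpace ℂ (H i)] : Submodule ℂ (HilbertTensorProduct H) :=
  LinearMap.range (UniformSpace.Completion.toComplₗᵢ (𝕜 := ℂ) (E := AlgTensor H)).toLinearMap

/-- The identification of the algebraic tensor product with its image in the completion. -/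
def algEquiv (H : ι → Type*) [∀ i, NormedAddCommGroup (H i)]
    [∀ i, InnerProductSpace ℂ (H i)] : AlgTensor H ≃ₗ[ℂ] algSubspace H :=
  LinearEquiv.ofInjective _ (UniformSpace.Completion.toComplₗᵢ (𝕜 := ℂ)).injective

/-- The operator `⨂ᵢ x i ↦ ⨂ᵢ A i (x i)` on the algebraic tensor product. -/
def algOp (A : ∀ i, H i →L[ℂ] H i) : AlgTensor H →ₗ[ℂ] AlgTensor H :=
  PiTensorProduct.map fun i => (A i).toLinearMap

lemma algOp_tprod (A : ∀ i, H i →L[ℂ] H i) (x : ∀ i, H i) :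
    algOp A (AlgTensor.tprod x) = AlgTensor.tprod fun i => A i (x i) :=
  PiTensorProduct.map_tprod _ x

/-- The operator `⨂ᵢ x i ↦ ⨂ᵢ A i (x i)`, extended linearly, as a densely defined operator on the
Hilbert space tensor product, with the algebraic tensor product as its domain. -/
def algOpPMap (A : ∀ i, H i →L[ℂ] H i) :
    HilbertTensorProduct H →ₗ.[ℂ] HilbertTensorProduct H where
  domain := algSubspace H
  toFun := (algSubspace H).subtype ∘ₗ (algEquiv H).toLinearMap ∘ₗ algOp A ∘ₗ
    (algEquiv H).symm.toLinearMap

/-- The tensor product `⨂ᵢ A i` of operators: the closure of the operator defined on the algebraic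
tensor product. -/
def tensorOp (A : ∀ i, H i →L[ℂ] H i) :
    HilbertTensorProduct H →ₗ.[ℂ] HilbertTensorProduct H :=
  (algOpPMap A).closure

end Operators

/-! ### Schatten-von Neumann classes and the trace -/

section Schatten

universe u

variable {E : Type u} [NormedAddCommGroup E] [InnerProductSpace ℂ E] [CompleteSpace E]

/-- `∑ₙ sₙ(T) ^ p`, where the `sₙ(T)` are the singular values of `T`, that is, the eigenvalues of
`|T| = √(T* T)` counted with multiplicity: each number `s ≥ 0` contributes `s ^ p` as many times as
the dimension of the eigenspace of `|T|` at `s`. (The value lies in `[0, ∞]`, and for `p > 0` only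
the positive eigenvalues contribute.) -/
def schattenSum (p : ℝ) (T : E →L[ℂ] E) : ℝ≥0∞ :=
  ∑' s : NNReal,
    ((Cardinal.toENat (Module.rank ℂ
        (Module.End.eigenspace (CFC.abs T).toLinearMap ((s : ℝ) : ℂ))) : ℕ∞) : ℝ≥0∞)
      * (s : ℝ≥0∞) ^ p

/-- Membership in the Schatten-von Neumann class `S_p`, for `0 < p < ∞`. -/
def MemSchatten (p : ℝ) (T : E →L[ℂ] E) : Prop :=
  IsCompactOperator T ∧ schattenSum p T < ∞

/-- The Schatten (quasi-)norm `(∑ₙ sₙ(T) ^ p) ^ (1 / p)` of an operator in `S_p`. -/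
def schattenNorm (p : ℝ) (T : E →L[ℂ] E) : ℝ :=
  (schattenSum p T).toReal ^ (1 / p)

/-- The series `∑ₖ ⟪φₖ, T φₖ⟫` converges absolutely with sum `t`, for every orthonormal
basis `φ`. -/
def HasTrace (T : E →L[ℂ] E) (t : ℂ) : Prop :=
  ∀ (κ : Type u) (φ : HilbertBasis κ ℂ E), HasSum (fun k => ⟪φ k, T (φ k)⟫_ℂ) t

/-- The trace `∑ₖ ⟪φₖ, T φₖ⟫`, computed in some orthonormal basis `φ`; it is meaningful for trace
class operators, where `HasTrace T (trace T)` says that any orthonormal basis gives this value. -/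
def trace (T : E →L[ℂ] E) : ℂ :=
  ∑' k, ⟪(exists_hilbertBasis ℂ E).choose_spec.choose k,
    T ((exists_hilbertBasis ℂ E).choose_spec.choose k)⟫_ℂ

end Schatten

end HilbertTensor

end

noncomputable section

namespace HilbertTensor

/-! ### Boundedness of the tensor product operator, its norm, and product Hilbert bases. -/

section BoundedOperators

variable {ι : Type*} [Fintype ι] {H : ι → Type*}
  [∀ i, NormedAddCommGroup (H i)] [∀ i, InnerProductSpace ℂ (H i)]

/-! On a finite sum `u = ∑ c k • ⨂ᵢ x k i`, the bound `‖(⨂ A i) u‖ ≤ (∏ ‖A i‖) ‖u‖` is positivity of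
a difference of two entrywise products of Gram matrices. It follows by telescoping over the factors
and the Schur product theorem (`posSemidef_prod_gram_sub_prod_gram_map`). Elementary tensors of
nearly maximising vectors show that the bound is sharp, and the bounded extension is the closure
because its graph is closed and the algebraic tensor product is dense.

For the Schatten classes, each compact `A j` has a Hilbert basis of eigenvectors of `|A j|`. Their
elementary tensors form a Hilbert basis (`exists_hilbertBasis_elemTensor`) in which `|⨂ A j|` is
diagonal, with the products of singular values as eigenvalues. So `∑ sₖ ^ p` factors as a product of
series, and its finiteness makes the tensor product compact.

The trace of an `S_1` operator is independent of the basis, by an absolutely convergent double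
series (`exists_hasTrace`). Computed in a product basis, the trace of `⨂ A j` factors as well. -/

lemma dotProduct_gram_mulVec {E : Type*} [NormedAddCommGroup E] [InnerProductSpace ℂ E] {n : ℕ}
    (v : Fin n → E) (c : Fin n → ℂ) :
    star c ⬝ᵥ Matrix.mulVec (Matrix.gram ℂ v) c = ((‖∑ k, c k • v k‖ ^ 2 : ℝ) : ℂ) := by
  have h := inner_self_eq_norm_sq_to_K (𝕜 := ℂ) (∑ k, c k • v k)
  simp only [sum_inner, inner_sum, inner_smul_left, inner_smul_right] at h
  push_cast
  refine Eq.trans ?_ h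
  simp only [dotProduct, Matrix.mulVec, Matrix.gram_apply, Pi.star_apply, Finset.mul_sum,
    RCLike.star_def]
  rw [Finset.sum_comm]
  exact Finset.sum_congr rfl fun k _ => Finset.sum_congr rfl fun l _ => by ring

/-- The quadratic form at `c` is `‖A‖² ‖v‖² - ‖A v‖²` with `v = ∑ c k • x k`. -/
lemma posSemidef_gram_sub_gram_map {E F : Type*} [NormedAddCommGroup E] [InnerProductSpace ℂ E]
    [NormedAddCommGroup F] [InnerProductSpace ℂ F] (A : E →L[ℂ] F) {n : ℕ} (x : Fin n → E) :
    (((‖A‖ ^ 2 : ℝ) : ℂ) • Matrix.gram ℂ x - Matrix.gram ℂ fun k => A (x k)).PosSemidef := by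
  refine Matrix.PosSemidef.of_dotProduct_mulVec_nonneg ?_ fun c => ?_
  · refine Matrix.IsHermitian.sub ?_ (Matrix.isHermitian_gram ..)
    have := Matrix.isHermitian_gram ℂ x
    rw [Matrix.IsHermitian, Matrix.conjTranspose_smul, this.eq]
    simp
  · rw [Matrix.sub_mulVec, Matrix.smul_mulVec, dotProduct_sub, dotProduct_smul,
      dotProduct_gram_mulVec, dotProduct_gram_mulVec, smul_eq_mul, ← Complex.ofReal_mul,
      ← Complex.ofReal_sub, Complex.zero_le_real, sub_nonneg, ← mul_pow]
    have h : ∑ k, c k • A (x k) = A (∑ k, c k • x k) := by simp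
    rw [h]
    exact pow_le_pow_left₀ (norm_nonneg _) (A.le_opNorm _) 2

/-- Telescoping: with `G`, `G'` the matrices of the new factor (`G` scaled by `‖A a‖²`) and `Q`,
`Q'` those of the factors in `s`, one has `G∘Q - G'∘Q' = G∘(Q - Q') + (G - G')∘Q'`. Both Hadamard
products are positive semidefinite by Schur's theorem. -/
lemma posSemidef_prod_gram_sub_prod_gram_map (A : ∀ i, H i →L[ℂ] H i) {n : ℕ}
    (x : Fin n → ∀ i, H i) (s : Finset ι) :
    (Matrix.of fun k l => ∏ i ∈ s, ((‖A i‖ ^ 2 : ℝ) : ℂ) * ⟪x k i, x l i⟫_ℂ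
        - ∏ i ∈ s, ⟪A i (x k i), A i (x l i)⟫_ℂ : Matrix (Fin n) (Fin n) ℂ).PosSemidef := by
  classical
  induction s using Finset.induction_on with
  | empty =>
    simp only [Finset.prod_empty, sub_self]
    exact Matrix.PosSemidef.zero
  | insert a s ha ih =>
    have h1 := (posSemidef_gram_sub_gram_map (A a) (fun k => x k a)).hadamard
      (posSemidef_prod_gram (fun k i => A i (x k i)) s)
    have h0 : (((‖A a‖ ^ 2 : ℝ) : ℂ) • Matrix.gram ℂ (fun k => x k a)).PosSemidef :=
      (Matrix.posSemidef_gram ℂ _).smul (by simp only [Complex.zero_le_real]; positivity)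
    convert! (h0.hadamard ih).add h1 using 1
    ext k l
    simp [Finset.prod_insert ha, Matrix.gram_apply, Matrix.hadamard]
    ring

lemma inner_self_sum_smul_tprod {n : ℕ} (c : Fin n → ℂ) (x : Fin n → ∀ i, H i) :
    ⟪∑ k, c k • AlgTensor.tprod (x k), ∑ k, c k • AlgTensor.tprod (x k)⟫_ℂ
      = star c ⬝ᵥ Matrix.mulVec
          (Matrix.of fun k l => ∏ i, ⟪x k i, x l i⟫_ℂ : Matrix (Fin n) (Fin n) ℂ) c := by
  simp only [alg_sum_left, alg_sum_right, alg_smul_left, alg_smul_right, inner_tprod, dotProduct,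
    Matrix.mulVec, Matrix.of_apply, Pi.star_apply, Finset.mul_sum, RCLike.star_def]
  rw [Finset.sum_comm]
  exact Finset.sum_congr rfl fun k _ => Finset.sum_congr rfl fun l _ => by ring

lemma norm_algOp_le (A : ∀ i, H i →L[ℂ] H i) (u : AlgTensor H) :
    ‖algOp A u‖ ≤ (∏ i, ‖A i‖) * ‖u‖ := by
  obtain ⟨n, c, x, rfl⟩ := exists_sum_tprod u
  have h := (posSemidef_prod_gram_sub_prod_gram_map A x Finset.univ).dotProduct_mulVec_nonneg c
  have e : (Matrix.of fun k l => ∏ i, ((‖A i‖ ^ 2 : ℝ) : ℂ) * ⟪x k i, x l i⟫_ℂ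
        - ∏ i, ⟪A i (x k i), A i (x l i)⟫_ℂ : Matrix (Fin n) (Fin n) ℂ)
      = (((∏ i, ‖A i‖) ^ 2 : ℝ) : ℂ) • (Matrix.of fun k l => ∏ i, ⟪x k i, x l i⟫_ℂ)
        - Matrix.of fun k l => ∏ i, ⟪A i (x k i), A i (x l i)⟫_ℂ := by
    ext k l
    simp [Finset.prod_mul_distrib, Finset.prod_pow]
  rw [e, Matrix.sub_mulVec, Matrix.smul_mulVec, dotProduct_sub, dotProduct_smul,
    ← inner_self_sum_smul_tprod, ← inner_self_sum_smul_tprod (x := fun k i => A i (x k i)),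
    smul_eq_mul] at h
  have hA : algOp A (∑ k, c k • AlgTensor.tprod (x k))
      = ∑ k, c k • AlgTensor.tprod fun i => A i (x k i) := by
    simp only [map_sum, map_smul, algOp_tprod]
  rw [← hA] at h
  erw [inner_self_eq_norm_sq_to_K (𝕜 := ℂ), inner_self_eq_norm_sq_to_K (𝕜 := ℂ)] at h
  have h' : (0 : ℂ) ≤ (((∏ i, ‖A i‖) ^ 2 * ‖∑ k, c k • AlgTensor.tprod (x k)‖ ^ 2
      - ‖algOp A (∑ k, c k • AlgTensor.tprod (x k))‖ ^ 2 : ℝ) : ℂ) := by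
    refine h.trans_eq ?_
    push_cast
    rfl
  rw [Complex.zero_le_real, sub_nonneg, ← mul_pow] at h'
  exact le_of_sq_le_sq h' (by positivity)

/-- The bounded operator `⨂ᵢ A i` on the Hilbert space tensor product. -/
def tensorCLM (A : ∀ i, H i →L[ℂ] H i) :
    HilbertTensorProduct H →L[ℂ] HilbertTensorProduct H :=
  ((UniformSpace.Completion.toComplₗᵢ (𝕜 := ℂ) (E := AlgTensor H)).toLinearMap ∘ₗ
    algOp A).extendOfNorm (UniformSpace.Completion.toComplₗᵢ (𝕜 := ℂ)).toLinearMap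

lemma denseRange_toComplₗᵢ :
    DenseRange (UniformSpace.Completion.toComplₗᵢ (𝕜 := ℂ) (E := AlgTensor H)).toLinearMap :=
  UniformSpace.Completion.denseRange_coe

lemma norm_toComplₗᵢ_algOp_le (A : ∀ i, H i →L[ℂ] H i) (u : AlgTensor H) :
    ‖((UniformSpace.Completion.toComplₗᵢ (𝕜 := ℂ) (E := AlgTensor H)).toLinearMap ∘ₗ algOp A) u‖
      ≤ (∏ i, ‖A i‖) *
        ‖(UniformSpace.Completion.toComplₗᵢ (𝕜 := ℂ) (E := AlgTensor H)).toLinearMap u‖ := by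
  simpa using norm_algOp_le A u

lemma tensorCLM_coe (A : ∀ i, H i →L[ℂ] H i) (u : AlgTensor H) :
    tensorCLM A (u : HilbertTensorProduct H) = (algOp A u : AlgTensor H) :=
  LinearMap.extendOfNorm_eq denseRange_toComplₗᵢ ⟨_, norm_toComplₗᵢ_algOp_le A⟩ u

/-- The elementary tensor `⨂ᵢ x i` in the Hilbert space tensor product. -/
def elemTensor (x : ∀ i, H i) : HilbertTensorProduct H := (AlgTensor.tprod x : AlgTensor H)

lemma tensorCLM_elemTensor (A : ∀ i, H i →L[ℂ] H i) (x : ∀ i, H i) :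
    tensorCLM A (elemTensor x) = elemTensor fun i => A i (x i) := by
  rw [elemTensor, tensorCLM_coe, algOp_tprod, elemTensor]

lemma inner_elemTensor (x y : ∀ i, H i) :
    ⟪elemTensor x, elemTensor y⟫_ℂ = ∏ i, ⟪x i, y i⟫_ℂ := by
  rw [elemTensor, elemTensor, UniformSpace.Completion.inner_coe, inner_tprod]

lemma norm_elemTensor (x : ∀ i, H i) : ‖elemTensor x‖ = ∏ i, ‖x i‖ := by
  have h : ‖elemTensor x‖ ^ 2 = (∏ i, ‖x i‖) ^ 2 := by
    have h := inner_elemTensor x x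
    simp only [inner_self_eq_norm_sq_to_K] at h
    rw [← Finset.prod_pow]
    exact_mod_cast h
  exact (pow_left_inj₀ (norm_nonneg _) (by positivity) two_ne_zero).1 h

lemma ext_inner_elemTensor {u v : HilbertTensorProduct H}
    (h : ∀ x : ∀ i, H i, ⟪u, elemTensor x⟫_ℂ = ⟪v, elemTensor x⟫_ℂ) : u = v := by
  refine ext_inner_right ℂ fun w => ?_
  induction w using UniformSpace.Completion.induction_on with
  | hp => exact isClosed_eq (by fun_prop) (by fun_prop)
  | ih a =>
    induction a using AlgTensor.induction with
    | h1 c x =>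
      rw [UniformSpace.Completion.coe_smul, inner_smul_right, inner_smul_right]
      exact congrArg (c * ·) (h x)
    | h2 a b ha hb =>
      rw [UniformSpace.Completion.coe_add, inner_add_right, inner_add_right, ha, hb]

lemma norm_tensorCLM (A : ∀ i, H i →L[ℂ] H i) : ‖tensorCLM A‖ = ∏ i, ‖A i‖ := by
  refine le_antisymm (LinearMap.opNorm_extendOfNorm_le denseRange_toComplₗᵢ (by positivity)
    (norm_toComplₗᵢ_algOp_le A)) ?_
  -- A zero factor is treated apart, since the strict inequality in `hx` below has no solution when
  -- `A i = 0`.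
  by_cases h0 : ∃ i, A i = 0
  · obtain ⟨i, hi⟩ := h0
    rw [Finset.prod_eq_zero (Finset.mem_univ i) (by simp [hi])]
    exact norm_nonneg _
  push Not at h0
  have key : ∀ c ∈ Set.Ioo (0 : ℝ) 1, c ^ Fintype.card ι * ∏ i, ‖A i‖ ≤ ‖tensorCLM A‖ := by
    intro c hc
    have hx : ∀ i, ∃ x : H i, c * ‖A i‖ * ‖x‖ < ‖A i x‖ := by
      intro i
      by_contra! h
      have := (A i).opNorm_le_bound (mul_nonneg hc.1.le (norm_nonneg _)) h
      have hA : 0 < ‖A i‖ := norm_pos_iff.2 (h0 i)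
      nlinarith [hc.2]
    choose x hx using hx
    have hpos : ∀ i, 0 < ‖x i‖ := by
      intro i
      rw [norm_pos_iff]
      intro h
      simpa [h] using hx i
    have h1 := (tensorCLM A).le_opNorm (elemTensor x)
    rw [tensorCLM_elemTensor, norm_elemTensor, norm_elemTensor] at h1
    have h2 : ∏ i, (c * ‖A i‖ * ‖x i‖) ≤ ∏ i, ‖A i (x i)‖ :=
      Finset.prod_le_prod (fun i _ => mul_nonneg (mul_nonneg hc.1.le (norm_nonneg _))
        (norm_nonneg _)) fun i _ => (hx i).le
    rw [Finset.prod_mul_distrib, Finset.prod_mul_distrib, Finset.prod_const,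
      Finset.card_univ] at h2
    exact le_of_mul_le_mul_right (h2.trans h1) (Finset.prod_pos fun i _ => hpos i)
  have hlim : Filter.Tendsto (fun c : ℝ => c ^ Fintype.card ι * ∏ i, ‖A i‖)
      (nhdsWithin 1 (Set.Iio 1)) (nhds (1 ^ Fintype.card ι * ∏ i, ‖A i‖)) :=
    ((continuous_pow _).mul continuous_const).continuousAt.tendsto.mono_left nhdsWithin_le_nhds
  rw [one_pow, one_mul] at hlim
  refine le_of_tendsto hlim ?_
  filter_upwards [Ioo_mem_nhdsLT (show (0 : ℝ) < 1 by norm_num)] with c hc using key c hc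

lemma mem_graph_algOpPMap (A : ∀ i, H i →L[ℂ] H i)
    (z : HilbertTensorProduct H × HilbertTensorProduct H) :
    z ∈ (algOpPMap A).graph ↔
      ∃ u : AlgTensor H, z = ((u : HilbertTensorProduct H), tensorCLM A u) := by
  have hcoe : ∀ u : AlgTensor H, ((algEquiv H u : algSubspace H) : HilbertTensorProduct H) = u :=
    fun u => rfl
  rw [LinearPMap.mem_graph_iff]
  constructor
  · rintro ⟨y, hy1, hy2⟩
    obtain ⟨u, rfl⟩ := (algEquiv H).surjective y
    refine ⟨u, Prod.ext (hy1.symm.trans (hcoe u)) ?_⟩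
    rw [← hy2, tensorCLM_coe]
    simp [algOpPMap, hcoe]
  · rintro ⟨u, rfl⟩
    refine ⟨algEquiv H u, hcoe u, ?_⟩
    rw [tensorCLM_coe]
    simp [algOpPMap, hcoe]

/-- The graph of a bounded operator is closed, and the continuous map `a ↦ (a, tensorCLM A a)` sends
a dense set to a dense subset of that graph. -/
lemma tensorOp_eq_tensorCLM (A : ∀ i, H i →L[ℂ] H i) :
    tensorOp A = (tensorCLM A).toLinearMap.toPMap ⊤ := by
  have hg : (algOpPMap A).graph.topologicalClosure
      = ((tensorCLM A).toLinearMap.toPMap ⊤).graph := by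
    ext z
    rw [← SetLike.mem_coe, Submodule.topologicalClosure_coe]
    have hz : z ∈ ((tensorCLM A).toLinearMap.toPMap ⊤).graph ↔ tensorCLM A z.1 = z.2 := by
      simp [LinearPMap.mem_graph_iff]
    rw [hz]
    constructor
    · intro h
      refine closure_minimal (s := ((algOpPMap A).graph : Set _))
        (t := {z : HilbertTensorProduct H × HilbertTensorProduct H | tensorCLM A z.1 = z.2}) ?_ (isClosed_eq (by fun_prop) (by fun_prop)) h
      intro w hw
      obtain ⟨u, rfl⟩ := (mem_graph_algOpPMap A w).1 hw
      rfl
    · intro h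
      obtain ⟨a, b⟩ := z
      obtain rfl : tensorCLM A a = b := h
      have hc : Continuous fun a : HilbertTensorProduct H => (a, tensorCLM A a) := by fun_prop
      have := hc.range_subset_closure_image_dense
        (UniformSpace.Completion.denseRange_coe (α := AlgTensor H)) ⟨a, rfl⟩
      refine closure_mono ?_ this
      rintro _ ⟨_, ⟨u, rfl⟩, rfl⟩
      exact (mem_graph_algOpPMap A _).2 ⟨u, rfl⟩
  -- `LinearPMap.closure` is the graph closure only for closable operators and otherwise returns the
  -- operator itself.
  have hcl : (algOpPMap A).IsClosable := ⟨_, hg⟩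
  exact LinearPMap.eq_of_eq_graph (hcl.graph_closure_eq_closure_graph.symm.trans hg)

/-- Elementary tensors of the vectors of Hilbert bases form a Hilbert basis. -/
lemma exists_hilbertBasis_elemTensor {κ : ι → Type*} (b : ∀ i, HilbertBasis (κ i) ℂ (H i)) :
    ∃ B : HilbertBasis (∀ i, κ i) ℂ (HilbertTensorProduct H),
      ∀ k, B k = elemTensor fun i => b i (k i) := by
  classical
  have ho : Orthonormal ℂ fun k : ∀ i, κ i => elemTensor fun i => b i (k i) := by
    rw [orthonormal_iff_ite]
    intro k l
    rw [inner_elemTensor]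
    simp only [fun i => orthonormal_iff_ite.1 (b i).orthonormal, Fintype.prod_ite_zero,
      Finset.prod_const_one, ← funext_iff]
  have hsp : (Submodule.span ℂ
      (Set.range fun k : ∀ i, κ i => elemTensor fun i => b i (k i)))ᗮ = ⊥ := by
    rw [Submodule.eq_bot_iff]
    intro u hu
    have h0 : ∀ k : ∀ i, κ i, ⟪u, elemTensor fun i => b i (k i)⟫_ℂ = 0 := fun k =>
      Submodule.inner_left_of_mem_orthogonal (Submodule.subset_span (Set.mem_range_self k)) hu
    -- Basis vectors are replaced by arbitrary vectors one slot at a time; `s` is the set of slots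
    -- already freed.
    have hs : ∀ (s : Finset ι) (x : ∀ i, H i), (∀ i ∉ s, ∃ k, x i = b i k) →
        ⟪u, elemTensor x⟫_ℂ = 0 := by
      intro s
      induction s using Finset.induction_on with
      | empty =>
        intro x hx
        choose k hk using fun i => hx i (Finset.notMem_empty i)
        rw [show x = fun i => b i (k i) from funext hk]
        exact h0 k
      | insert a s ha ih =>
        intro x hx
        -- The functional obtained by varying slot `a` alone is continuous and vanishes on the basis
        -- `b a`, hence everywhere.
        let f : H a →L[ℂ] ℂ := LinearMap.mkContinuous
          (((innerSL ℂ u).toLinearMap ∘ₗ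
            (UniformSpace.Completion.toComplₗᵢ (𝕜 := ℂ) (E := AlgTensor H)).toLinearMap) ∘ₗ
            ((PiTensorProduct.tprod ℂ).toLinearMap x a : H a →ₗ[ℂ] AlgTensor H))
          (‖u‖ * ∏ i ∈ Finset.univ.erase a, ‖x i‖) (by
            intro z
            change ‖⟪u, elemTensor (Function.update x a z)⟫_ℂ‖ ≤ _
            refine (norm_inner_le_norm _ _).trans ?_
            have hp : ∏ i ∈ Finset.univ.erase a, ‖Function.update x a z i‖
                = ∏ i ∈ Finset.univ.erase a, ‖x i‖ := Finset.prod_congr rfl fun i hi => by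
              rw [Function.update_of_ne (Finset.ne_of_mem_erase hi)]
            rw [norm_elemTensor, ← Finset.mul_prod_erase _ _ (Finset.mem_univ a),
              Function.update_self, hp]
            exact le_of_eq (by ring))
        have hf : ∀ z, f z = ⟪u, elemTensor (Function.update x a z)⟫_ℂ := fun z => rfl
        have hf0 : f = 0 := by
          refine ContinuousLinearMap.ext_on
            (Submodule.dense_iff_topologicalClosure_eq_top.2 (b a).dense_span) ?_
          rintro _ ⟨k, rfl⟩
          rw [hf]
          refine ih _ fun i hi => ?_
          by_cases hia : i = a
          · subst hia; exact ⟨k, by simp⟩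
          · rw [Function.update_of_ne hia]
            exact hx i (by simp [hia, hi])
        have := hf (x a)
        rw [hf0, Function.update_eq_self] at this
        exact this.symm
    refine ext_inner_elemTensor fun x => ?_
    rw [inner_zero_left]
    exact hs Finset.univ x fun i hi => absurd (Finset.mem_univ i) hi
  exact ⟨HilbertBasis.mkOfOrthogonalEqBot ho hsp, fun k => by
    rw [HilbertBasis.coe_mkOfOrthogonalEqBot]⟩

/-- Testing against elementary tensors suffices, so the adjoint of the tensor product need not be
identified. -/
lemma star_mul_tensorCLM_elemTensor [∀ i, CompleteSpace (H i)] (A : ∀ i, H i →L[ℂ] H i)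
    (x : ∀ i, H i) (c : ι → ℝ) (h : ∀ i, (star (A i) * A i) (x i) = (c i : ℂ) • x i) :
    (star (tensorCLM A) * tensorCLM A) (elemTensor x) = ((∏ i, c i : ℝ) : ℂ) • elemTensor x := by
  refine ext_inner_elemTensor fun y => ?_
  rw [mul_apply_eq_comp, ContinuousLinearMap.star_eq_adjoint,
    ContinuousLinearMap.adjoint_inner_left, tensorCLM_elemTensor, tensorCLM_elemTensor,
    inner_elemTensor, inner_smul_left, inner_elemTensor, Complex.conj_ofReal, Complex.ofReal_prod,
    ← Finset.prod_mul_distrib]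
  refine Finset.prod_congr rfl fun i _ => ?_
  rw [← ContinuousLinearMap.adjoint_inner_left, ← ContinuousLinearMap.star_eq_adjoint,
    ← mul_apply_eq_comp, h i, inner_smul_left, Complex.conj_ofReal]

end BoundedOperators

/-! ### The absolute value of an operator and its diagonalisation. -/

section SpectralTheory

universe u

variable {E : Type u} [NormedAddCommGroup E] [InnerProductSpace ℂ E] [CompleteSpace E]

lemma abs_isPositive (T : E →L[ℂ] E) : (CFC.abs T).IsPositive :=
  ContinuousLinearMap.nonneg_iff_isPositive _ |>.1 (CFC.abs_nonneg T)

lemma abs_isSymmetric (T : E →L[ℂ] E) : (CFC.abs T).IsSymmetric :=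
  (abs_isPositive T).isSymmetric

lemma abs_abs_apply (T : E →L[ℂ] E) (x : E) :
    CFC.abs T (CFC.abs T x) = (star T * T) x := by
  rw [← CFC.abs_mul_abs, mul_apply_eq_comp]

lemma norm_abs_apply (T : E →L[ℂ] E) (x : E) : ‖CFC.abs T x‖ = ‖T x‖ := by
  have h : ⟪CFC.abs T x, CFC.abs T x⟫_ℂ = ⟪T x, T x⟫_ℂ := by
    have h1 : ⟪CFC.abs T (CFC.abs T x), x⟫_ℂ = ⟪CFC.abs T x, CFC.abs T x⟫_ℂ :=
      abs_isSymmetric T _ _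
    rw [← h1, abs_abs_apply, mul_apply_eq_comp,
      ContinuousLinearMap.star_eq_adjoint, ContinuousLinearMap.adjoint_inner_left]
  rw [inner_self_eq_norm_sq_to_K, inner_self_eq_norm_sq_to_K] at h
  have h' : ‖CFC.abs T x‖ ^ 2 = ‖T x‖ ^ 2 := by exact_mod_cast h
  exact (pow_left_inj₀ (norm_nonneg _) (norm_nonneg _) two_ne_zero).1 h'

/-- Since `‖S x - S y‖ ≤ ‖T x - T y‖`, preimages in the ball of an ε-net for the image under `T`
give an ε-net for the image under `S`. With `norm_abs_apply` this transfers compactness between `T`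
and `|T|` in both directions. -/
lemma isCompactOperator_of_norm_le {S T : E →L[ℂ] E} (hT : IsCompactOperator T)
    (h : ∀ x, ‖S x‖ ≤ ‖T x‖) : IsCompactOperator S := by
  have hb : TotallyBounded (T '' Metric.closedBall 0 1) :=
    (hT.isCompact_closure_image_closedBall (f := T.toLinearMap) 1).totallyBounded.subset
      subset_closure
  have hb' : TotallyBounded (S '' Metric.closedBall 0 1) := by
    rw [Metric.totallyBounded_iff]
    intro ε hε
    obtain ⟨t, ht, htf, hcov⟩ := totallyBounded_iff_subset.1 hb _ (Metric.dist_mem_uniformity hε)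
    choose! g hg hgT using fun y (hy : y ∈ t) => (Set.mem_image _ _ _).1 (ht hy)
    refine ⟨(fun y => S (g y)) '' t, htf.image _, ?_⟩
    rintro _ ⟨x, hx, rfl⟩
    have := hcov (Set.mem_image_of_mem T hx)
    obtain ⟨y, hy, hxy⟩ := Set.mem_iUnion₂.1 this
    refine Set.mem_iUnion₂.2 ⟨_, Set.mem_image_of_mem _ hy, ?_⟩
    rw [Metric.mem_ball, dist_eq_norm, ← map_sub]
    refine (h _).trans_lt ?_
    rw [map_sub, hgT y hy, ← dist_eq_norm]
    exact hxy
  refine (isCompactOperator_iff_isCompact_closure_image_closedBall S.toLinearMap one_pos).2 ?_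
  exact hb'.closure.isCompact_of_isClosed isClosed_closure

/-- From `(|T| + μ)(|T| - μ) x = 0`, the vector `y = (|T| - μ) x` satisfies `|T| y = -μ y`, and
positivity of `|T|` forces `y = 0` when `μ > 0`. For `μ = 0`, `‖|T| x‖² = ⟪|T|² x, x⟫ = 0`. -/
lemma abs_eq_smul_of_sq {T : E →L[ℂ] E} {x : E} {μ : ℝ} (hμ : 0 ≤ μ)
    (h : (star T * T) x = ((μ ^ 2 : ℝ) : ℂ) • x) : CFC.abs T x = (μ : ℂ) • x := by
  rw [← abs_abs_apply] at h
  rcases hμ.eq_or_lt with rfl | hμ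
  · have h0 : ⟪CFC.abs T (CFC.abs T x), x⟫_ℂ = ⟪CFC.abs T x, CFC.abs T x⟫_ℂ :=
      abs_isSymmetric T _ _
    rw [h] at h0
    simp only [ne_eq, OfNat.ofNat_ne_zero, not_false_eq_true, zero_pow, Complex.ofReal_zero,
      zero_smul, inner_zero_left] at h0
    rw [inner_self_eq_zero.1 h0.symm]; simp
  · set y := CFC.abs T x - (μ : ℂ) • x with hy
    have h1 : CFC.abs T y = -(μ : ℂ) • y := by
      rw [hy, map_sub, map_smul, h]
      push_cast
      module
    have h2 : 0 ≤ RCLike.re ⟪CFC.abs T y, y⟫_ℂ := (abs_isPositive T).re_inner_nonneg_left y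
    rw [h1, inner_smul_left, inner_self_eq_norm_sq_to_K] at h2
    have h3 : 0 ≤ -(μ * ‖y‖ ^ 2) := by
      refine h2.trans_eq ?_
      have : (starRingEnd ℂ) (-(μ : ℂ)) * ((‖y‖ : ℂ)) ^ 2 = ((-(μ * ‖y‖ ^ 2) : ℝ) : ℂ) := by
        simp
      erw [this]
      rfl
    have h4 : ‖y‖ = 0 := by
      by_contra hne
      have : 0 < ‖y‖ ^ 2 := by positivity
      nlinarith
    rwa [norm_eq_zero, hy, sub_eq_zero (a := CFC.abs T x)] at h4

/-- Spectral theorem for a compact operator: `|T|` is diagonal in some Hilbert basis. -/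
lemma exists_hilbertBasis_abs_apply {T : E →L[ℂ] E} (hT : IsCompactOperator T) :
    ∃ (κ : Type u) (b : HilbertBasis κ ℂ E) (μ : κ → NNReal),
      ∀ k, CFC.abs T (b k) = ((μ k : ℝ) : ℂ) • b k := by
  have hc : IsCompactOperator (CFC.abs T : E →L[ℂ] E) :=
    isCompactOperator_of_norm_le hT fun x => (norm_abs_apply T x).le
  let V : ℂ → Submodule ℂ E := fun z => Module.End.eigenspace (CFC.abs T).toLinearMap z
  have hV : ∀ z, CompleteSpace (V z) := fun z => by
    have : IsClosed (V z : Set E) := by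
      have : (V z : Set E) = {x | CFC.abs T x = z • x} := by
        ext x; simp [V]
      rw [this]
      exact isClosed_eq (by fun_prop) (by fun_prop)
    exact this.completeSpace_coe
  choose w b hb using fun z => exists_hilbertBasis ℂ (V z)
  have hortho : OrthogonalFamily ℂ (fun z => V z) fun z => (V z).subtypeₗᵢ :=
    (abs_isSymmetric T).orthogonalFamily_eigenspaces
  let v : (Σ z, w z) → E := fun a => (b a.1 a.2 : V a.1)
  have hv : Orthonormal ℂ v :=
    hortho.orthonormal_sigma_orthonormal fun z => (b z).orthonormal
  have hsp : (Submodule.span ℂ (Set.range v))ᗮ = ⊥ := by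
    rw [eq_bot_iff, ← ContinuousLinearMap.orthogonalComplement_iSup_eigenspaces_eq_bot hc
      (abs_isSymmetric T)]
    intro x hx
    rw [← Submodule.iInf_orthogonal, Submodule.mem_iInf]
    intro z
    have h0 : (innerSL ℂ x ∘L (V z).subtypeL : V z →L[ℂ] ℂ) = 0 := by
      refine ContinuousLinearMap.ext_on
        (Submodule.dense_iff_topologicalClosure_eq_top.2 (b z).dense_span) ?_
      rintro _ ⟨k, rfl⟩
      exact Submodule.inner_left_of_mem_orthogonal
        (Submodule.subset_span (Set.mem_range_self (⟨z, k⟩ : Σ z, w z))) hx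
    rw [Submodule.mem_orthogonal']
    intro y hy
    exact DFunLike.congr_fun h0 (⟨y, hy⟩ : V z)
  have hv' : Orthonormal ℂ (fun y : Set.range v => (y : E)) := hv.toSubtypeRange
  have hsp' : (Submodule.span ℂ (Set.range fun y : Set.range v => (y : E)))ᗮ = ⊥ := by
    rw [Subtype.range_coe]; exact hsp
  have hev : ∀ y : Set.range v, ∃ μ : NNReal, CFC.abs T (y : E) = ((μ : ℝ) : ℂ) • (y : E) := by
    rintro ⟨_, ⟨z, k⟩, rfl⟩
    have hz : CFC.abs T (v ⟨z, k⟩) = z • v ⟨z, k⟩ :=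
      Module.End.mem_eigenspace_iff.1 (b z k).2
    have hn : ⟪v ⟨z, k⟩, v ⟨z, k⟩⟫_ℂ = 1 := by
      rw [inner_self_eq_norm_sq_to_K, hv.1]; simp
    -- For the unit eigenvector this inner product equals `z`, so positivity of `|T|` makes `z` real
    -- and nonnegative.
    have hp : 0 ≤ ⟪v ⟨z, k⟩, CFC.abs T (v ⟨z, k⟩)⟫_ℂ := (abs_isPositive T).inner_nonneg_right _
    rw [hz, inner_smul_right, hn, mul_one] at hp
    obtain ⟨hre, him⟩ := Complex.le_def.1 hp
    refine ⟨⟨z.re, hre⟩, ?_⟩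
    rw [hz]
    congr 1
    exact Complex.ext rfl him.symm
  choose μ hμ using hev
  exact ⟨Set.range v, HilbertBasis.mkOfOrthogonalEqBot hv' hsp', μ, fun k => by
    rw [HilbertBasis.coe_mkOfOrthogonalEqBot]; exact hμ k⟩

/-! ### Singular values read off a diagonalising basis. -/

section Diagonal

omit [CompleteSpace E] in
lemma hasSum_norm_sq_inner {κ : Type*} (b : HilbertBasis κ ℂ E) (x : E) :
    HasSum (fun k => ‖⟪b k, x⟫_ℂ‖ ^ 2) (‖x‖ ^ 2) := by
  have h := b.hasSum_inner_mul_inner x x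
  rw [inner_self_eq_norm_sq_to_K] at h
  have h2 : ∀ k, ⟪x, b k⟫_ℂ * ⟪b k, x⟫_ℂ = ((‖⟪b k, x⟫_ℂ‖ ^ 2 : ℝ) : ℂ) := by
    intro k
    rw [← inner_conj_symm, mul_comm, Complex.mul_conj, Complex.normSq_eq_norm_sq]
  simp only [h2] at h
  refine Complex.hasSum_ofReal.1 ?_
  rw [Complex.ofReal_pow]
  exact h

variable {κ : Type*} {T : E →L[ℂ] E} {b : HilbertBasis κ ℂ E} {μ : κ → NNReal}

lemma inner_abs_apply (h : ∀ k, CFC.abs T (b k) = ((μ k : ℝ) : ℂ) • b k) (k : κ) (x : E) :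
    ⟪b k, CFC.abs T x⟫_ℂ = ((μ k : ℝ) : ℂ) * ⟪b k, x⟫_ℂ := by
  have h1 : ⟪CFC.abs T (b k), x⟫_ℂ = ⟪b k, CFC.abs T x⟫_ℂ := abs_isSymmetric T _ _
  rw [← h1, h, inner_smul_left, Complex.conj_ofReal]

/-- The basis vectors with `μ k = s` are independent in the eigenspace, and an eigenvector for `s`
has zero coefficient on every other basis vector. If there are infinitely many, the lower bound is
already `⊤`. -/
lemma toENat_rank_eigenspace_abs (h : ∀ k, CFC.abs T (b k) = ((μ k : ℝ) : ℂ) • b k)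
    (s : NNReal) :
    Cardinal.toENat (Module.rank ℂ
      (Module.End.eigenspace (CFC.abs T).toLinearMap ((s : ℝ) : ℂ))) = {k | μ k = s}.encard := by
  classical
  set V := Module.End.eigenspace (CFC.abs T).toLinearMap ((s : ℝ) : ℂ) with hV
  have hmem : ∀ k : {k | μ k = s}, b k ∈ V := by
    rintro ⟨k, rfl⟩
    exact Module.End.mem_eigenspace_iff.2 (h k)
  have hli : LinearIndependent ℂ fun k : {k | μ k = s} => (⟨b k, hmem k⟩ : V) := by
    have := b.orthonormal.linearIndependent.comp (Subtype.val : {k | μ k = s} → κ)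
      Subtype.val_injective
    exact LinearIndependent.of_comp V.subtype this
  have hli' := hli.cardinal_lift_le_rank
  have hle : {k | μ k = s}.encard ≤ Cardinal.toENat (Module.rank ℂ V) := by
    have := OrderHomClass.mono Cardinal.toENat hli'
    simpa using this
  refine le_antisymm ?_ hle
  rcases Set.finite_or_infinite {k | μ k = s} with hf | hf
  · have hsub : V ≤ Submodule.span ℂ (b '' {k | μ k = s}) := by
      intro x hx
      have hx' : CFC.abs T x = ((s : ℝ) : ℂ) • x := Module.End.mem_eigenspace_iff.1 hx
      have h0 : ∀ k ∉ hf.toFinset, ⟪b k, x⟫_ℂ • b k = 0 := by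
        intro k hk
        have h1 := inner_abs_apply h k x
        rw [hx', inner_smul_right] at h1
        have h2 : (((s : ℝ) : ℂ) - ((μ k : ℝ) : ℂ)) * ⟪b k, x⟫_ℂ = 0 := by
          rw [sub_mul, h1, sub_self]
        rcases mul_eq_zero.1 h2 with h3 | h3
        · refine absurd ?_ hk
          rw [Set.Finite.mem_toFinset]
          have : (s : ℝ) = μ k := by exact_mod_cast sub_eq_zero.1 h3
          exact (NNReal.coe_injective this).symm
        · rw [h3, zero_smul]
      have hs := b.hasSum_repr x
      simp only [HilbertBasis.repr_apply_apply] at hs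
      rw [hs.unique (hasSum_sum_of_ne_finset_zero h0)]
      refine Submodule.sum_mem _ fun k hk => Submodule.smul_mem _ _ (Submodule.subset_span ?_)
      exact Set.mem_image_of_mem _ (hf.mem_toFinset.1 hk)
    have h1 := (Submodule.rank_mono hsub).trans (rank_span_le _)
    have h2 := OrderHomClass.mono Cardinal.toENat h1
    refine h2.trans ?_
    change (b '' {k | μ k = s}).encard ≤ _
    exact Set.encard_image_le _ _
  · rw [hf.encard_eq]; exact le_top

/-- Grouping the indices by the value of `μ` turns the sum over `k` into the sum over eigenvalues
with multiplicity. -/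
lemma schattenSum_eq_tsum (h : ∀ k, CFC.abs T (b k) = ((μ k : ℝ) : ℂ) • b k) (p : ℝ) :
    schattenSum p T = ∑' k, (μ k : ℝ≥0∞) ^ p := by
  rw [schattenSum, ← (Equiv.sigmaFiberEquiv μ).tsum_eq, ENNReal.tsum_sigma']
  refine tsum_congr fun s => ?_
  rw [toENat_rank_eigenspace_abs h]
  have : ∀ a : {k // μ k = s}, (μ (Equiv.sigmaFiberEquiv μ ⟨s, a⟩) : ℝ≥0∞) ^ p
      = (s : ℝ≥0∞) ^ p := by
    rintro ⟨a, rfl⟩; rfl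
  simp only [this]
  rw [ENNReal.tsum_const]
  rfl

lemma norm_apply_hilbertBasis (h : ∀ k, CFC.abs T (b k) = ((μ k : ℝ) : ℂ) • b k) (k : κ) :
    ‖T (b k)‖ = μ k := by
  rw [← norm_abs_apply, h, norm_smul, b.orthonormal.1]
  simp

/-- Summability forces `μ k → 0`, so `|T|` is a norm limit of its finite-rank diagonal truncations
`F s`. This yields compactness of the tensor product from its diagonal form. -/
lemma isCompactOperator_of_schattenSum_lt_top
    (h : ∀ k, CFC.abs T (b k) = ((μ k : ℝ) : ℂ) • b k) {p : ℝ} (hp : 0 < p)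
    (hs : schattenSum p T < ∞) : IsCompactOperator T := by
  classical
  refine isCompactOperator_of_norm_le (T := CFC.abs T) ?_ fun x => (norm_abs_apply T x).ge
  rw [schattenSum_eq_tsum h] at hs
  let F : Finset κ → E →L[ℂ] E := fun s =>
    ∑ k ∈ s, ((μ k : ℝ) : ℂ) • (innerSL ℂ (b k)).smulRight (b k)
  have hFk : ∀ s k x, ⟪b k, F s x⟫_ℂ = if k ∈ s then ((μ k : ℝ) : ℂ) * ⟪b k, x⟫_ℂ else 0 := by
    intro s k x
    simp only [F, sum_apply, inner_sum, smul_apply,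
      ContinuousLinearMap.smulRight_apply, inner_smul_right, innerSL_apply_apply,
      orthonormal_iff_ite.1 b.orthonormal]
    simp
  have hF : ∀ s, IsCompactOperator (F s) := by
    intro s
    refine (compactOperator (RingHom.id ℂ) E E).sum_mem fun k _ => Submodule.smul_mem _ _ ?_
    have h1 : IsCompactOperator (ContinuousLinearMap.toSpanSingleton ℂ (b k)) :=
      isCompactOperator_of_locallyCompactSpace_rng _
    exact h1.comp_clm (innerSL ℂ (b k))
  refine isCompactOperator_of_tendsto (F := F) (l := Filter.atTop) ?_
    (Filter.Eventually.of_forall hF)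
  rw [Metric.tendsto_atTop]
  intro ε hε
  have hlim := ENNReal.tendsto_cofinite_zero_of_tsum_ne_top hs.ne
  have hε' : (0 : ℝ≥0∞) < ENNReal.ofReal (ε / 2) ^ p :=
    ENNReal.rpow_pos (by simpa using hε) ENNReal.ofReal_ne_top
  have hfin := (hlim.eventually (gt_mem_nhds hε'))
  rw [Filter.eventually_cofinite] at hfin
  refine ⟨hfin.toFinset, fun s (hss : hfin.toFinset ⊆ s) => ?_⟩
  rw [dist_eq_norm]
  refine lt_of_le_of_lt ((F s - CFC.abs T).opNorm_le_bound (by positivity) fun x => ?_)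
    (half_lt_self hε)
  refine le_of_sq_le_sq ?_ (by positivity)
  rw [mul_pow]
  -- By Parseval the norms are compared coordinatewise: coordinates in `s` cancel, the others carry
  -- a factor at most `ε / 2`.
  refine hasSum_le (fun k => ?_) (hasSum_norm_sq_inner b _) ((hasSum_norm_sq_inner b x).mul_left _)
  rw [sub_apply, inner_sub_right, hFk, inner_abs_apply h]
  split_ifs with hk
  · simp; positivity
  · rw [zero_sub, norm_neg, norm_mul, mul_pow]
    gcongr
    have hk' : k ∉ hfin.toFinset := fun hk' => hk (hss hk')
    rw [Set.Finite.mem_toFinset, Set.mem_ofPred_eq, not_not,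
      ENNReal.rpow_lt_rpow_iff hp] at hk'
    rw [Complex.norm_real, Real.norm_of_nonneg (μ k).coe_nonneg]
    exact ((ENNReal.lt_ofReal_iff_toReal_lt ENNReal.coe_ne_top).1 hk').le

end Diagonal

/-- Expanding in the eigenbasis `b` and an arbitrary basis `φ` gives a double series whose row sums
are `⟪b n, T (b n)⟫` and column sums `⟪φ k, T (φ k)⟫`. It converges absolutely because row `n` has
absolute sum at most `μ n`, so the order of summation can be exchanged. -/
lemma exists_hasTrace {T : E →L[ℂ] E} (hT : MemSchatten 1 T) : ∃ t, HasTrace T t := by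
  obtain ⟨κ, b, μ, hμ⟩ := exists_hilbertBasis_abs_apply hT.1
  have hsum : Summable fun k => (μ k : ℝ) := by
    have h := hT.2
    rw [schattenSum_eq_tsum hμ] at h
    simp only [ENNReal.rpow_one] at h
    exact NNReal.summable_coe.2 (ENNReal.tsum_coe_ne_top_iff_summable.1 h.ne)
  refine ⟨∑' n, ⟪b n, T (b n)⟫_ℂ, fun κ' φ => ?_⟩
  let f : κ × κ' → ℂ := fun q => ⟪b q.1, φ q.2⟫_ℂ * ⟪φ q.2, T (b q.1)⟫_ℂ
  have hrow : ∀ n, HasSum (fun k => f (n, k)) ⟪b n, T (b n)⟫_ℂ := fun n =>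
    φ.hasSum_inner_mul_inner (b n) (T (b n))
  have hbound : ∀ n, Summable (fun k => ‖f (n, k)‖) ∧ ∑' k, ‖f (n, k)‖ ≤ μ n := by
    intro n
    -- Weighted AM-GM, with weight `μ n` chosen so that both terms sum over `k` to `μ n`, as `‖T (b
    -- n)‖ = μ n`. If `μ n = 0`, then `T (b n) = 0` and both sides vanish.
    have hle : ∀ k, ‖f (n, k)‖ ≤
        (μ n * ‖⟪φ k, b n⟫_ℂ‖ ^ 2 + (μ n : ℝ)⁻¹ * ‖⟪φ k, T (b n)⟫_ℂ‖ ^ 2) / 2 := by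
      intro k
      rw [norm_mul, norm_inner_symm]
      rcases eq_or_ne (μ n) 0 with h0 | h0
      · have : T (b n) = 0 := by
          rw [← norm_eq_zero, norm_apply_hilbertBasis hμ, h0]; rfl
        simp [this, h0]
      · have hpos : (0 : ℝ) < μ n := by positivity
        have : (μ n * ‖⟪φ k, b n⟫_ℂ‖ ^ 2 + (μ n : ℝ)⁻¹ * ‖⟪φ k, T (b n)⟫_ℂ‖ ^ 2) / 2
            - ‖⟪φ k, b n⟫_ℂ‖ * ‖⟪φ k, T (b n)⟫_ℂ‖
            = (μ n : ℝ)⁻¹ * (μ n * ‖⟪φ k, b n⟫_ℂ‖ - ‖⟪φ k, T (b n)⟫_ℂ‖) ^ 2 / 2 := by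
          field_simp
          ring
        rw [← sub_nonneg, this]
        positivity
    have hs := (((hasSum_norm_sq_inner φ (b n)).mul_left (μ n : ℝ)).add
      ((hasSum_norm_sq_inner φ (T (b n))).mul_left (μ n : ℝ)⁻¹)).div_const 2
    have hs1 : Summable fun k => ‖f (n, k)‖ :=
      Summable.of_nonneg_of_le (fun _ => norm_nonneg _) hle hs.summable
    refine ⟨hs1, (hasSum_le hle hs1.hasSum hs).trans_eq ?_⟩
    rw [norm_apply_hilbertBasis hμ, b.orthonormal.1]
    rcases eq_or_ne (μ n) 0 with h0 | h0
    · simp [h0]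
    · have hpos : (μ n : ℝ) ≠ 0 := by exact_mod_cast h0
      field_simp
      ring
  have hf : Summable f := by
    refine Summable.of_norm ?_
    rw [summable_prod_of_nonneg fun _ => norm_nonneg _]
    exact ⟨fun n => (hbound n).1, Summable.of_nonneg_of_le (fun n => tsum_nonneg fun _ =>
      norm_nonneg _) (fun n => (hbound n).2) hsum⟩
  have hcol : ∀ k, HasSum (fun n => f (n, k)) ⟪φ k, T (φ k)⟫_ℂ := by
    intro k
    have h1 := b.hasSum_inner_mul_inner (ContinuousLinearMap.adjoint T (φ k)) (φ k)
    simp only [ContinuousLinearMap.adjoint_inner_left] at h1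
    simpa only [f, mul_comm] using h1
  have h1 : HasSum f (∑' n, ⟪b n, T (b n)⟫_ℂ) := by
    have := hf.hasSum.prod_fiberwise hrow
    rw [this.tsum_eq]; exact hf.hasSum
  have h2 : HasSum (fun q : κ' × κ => f (q.2, q.1)) (∑' n, ⟪b n, T (b n)⟫_ℂ) :=
    (Equiv.prodComm κ' κ).hasSum_iff.2 h1
  exact h2.prod_fiberwise hcol

lemma hasTrace_trace {T : E →L[ℂ] E} (hT : MemSchatten 1 T) : HasTrace T (trace T) := by
  obtain ⟨t, ht⟩ := exists_hasTrace hT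
  rwa [show trace T = t from
    (ht _ (exists_hilbertBasis ℂ E).choose_spec.choose).tsum_eq]

end SpectralTheory

/-! ### Products of series as series over product indices. -/

section ProductSums

lemma tsum_pi_prod_ennreal {n : ℕ} {κ : Fin n → Type*} (f : ∀ i, κ i → ℝ≥0∞) :
    ∑' k : ∀ i, κ i, ∏ i, f i (k i) = ∏ i, ∑' k, f i k := by
  induction n with
  | zero => simp [tsum_fintype]
  | succ n ih =>
    rw [← (Fin.consEquiv κ).tsum_eq, ENNReal.tsum_prod']
    simp only [Fin.consEquiv_apply, Fin.prod_univ_succ, Fin.cons_zero, Fin.cons_succ,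
      ENNReal.tsum_mul_left, ENNReal.tsum_mul_right]
    rw [ih fun i => f i.succ]

lemma hasSum_pi_prod {n : ℕ} {κ : Fin n → Type*} {f : ∀ i, κ i → ℂ} {t : Fin n → ℂ}
    (h : ∀ i, HasSum (f i) (t i)) :
    HasSum (fun k : ∀ i, κ i => ∏ i, f i (k i)) (∏ i, t i) := by
  induction n with
  | zero => simp
  | succ n ih =>
    rw [← (Fin.consEquiv κ).hasSum_iff, Fin.prod_univ_succ]
    let g : (∀ i : Fin n, κ i.succ) → ℂ := fun k => ∏ i, f i.succ (k i)
    have h1 : HasSum g (∏ i : Fin n, t i.succ) := ih fun i => h i.succ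
    have hs : Summable fun q : κ 0 × (∀ i : Fin n, κ i.succ) => f 0 q.1 * g q.2 :=
      summable_mul_of_summable_norm (f := f 0) (g := g) (h 0).summable.norm h1.summable.norm
    have h2 : HasSum (fun q : κ 0 × (∀ i : Fin n, κ i.succ) => f 0 q.1 * g q.2)
        (t 0 * ∏ i : Fin n, t i.succ) := HasSum.mul (h 0) h1 hs
    refine h2.congr_fun fun q => ?_
    simp [Fin.prod_univ_succ, g]

end ProductSums

/-! ### Multiplicativity of Schatten norms and traces. -/

section Main

variable {n : ℕ} {H : Fin n → Type*} [∀ j, NormedAddCommGroup (H j)]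
  [∀ j, InnerProductSpace ℂ (H j)] [∀ j, CompleteSpace (H j)]

/-- For compact factors, `∑ sₖ ^ p` is multiplicative under tensor products. -/
lemma schattenSum_tensorCLM {A : ∀ j, H j →L[ℂ] H j}
    (hA : ∀ j, IsCompactOperator (A j)) (p : ℝ) (hp : 0 < p) :
    schattenSum p (tensorCLM A) = ∏ j, schattenSum p (A j) ∧
      (schattenSum p (tensorCLM A) < ∞ → IsCompactOperator (tensorCLM A)) := by
  choose κ b μ hμ using fun j => exists_hilbertBasis_abs_apply (hA j)
  obtain ⟨B, hB⟩ := exists_hilbertBasis_elemTensor b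
  have hT : ∀ k, CFC.abs (tensorCLM A) (B k) = (((∏ j, μ j (k j) : NNReal) : ℝ) : ℂ) • B k := by
    intro k
    refine abs_eq_smul_of_sq (NNReal.coe_nonneg _) ?_
    -- The eigenvalue of `T* T` is computed first, from those of the `A j* A j`; `abs_eq_smul_of_sq`
    -- then takes the root.
    rw [hB, star_mul_tensorCLM_elemTensor A _ fun j => (μ j (k j) : ℝ) ^ 2]
    · rw [NNReal.coe_prod, Finset.prod_pow]
    · intro j
      rw [← abs_abs_apply, hμ, map_smul, hμ, smul_smul, Complex.ofReal_pow, sq]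
  refine ⟨?_, isCompactOperator_of_schattenSum_lt_top hT hp⟩
  rw [schattenSum_eq_tsum hT]
  simp only [fun j => schattenSum_eq_tsum (hμ j) p]
  rw [← tsum_pi_prod_ennreal fun j k => (μ j k : ℝ≥0∞) ^ p]
  refine tsum_congr fun k => ?_
  rw [ENNReal.ofNNReal_finsetProd, ENNReal.prod_rpow_of_nonneg hp.le]

lemma memSchatten_tensorCLM {A : ∀ j, H j →L[ℂ] H j} {p : ℝ} (hp : 0 < p)
    (hA : ∀ j, MemSchatten p (A j)) :
    MemSchatten p (tensorCLM A) ∧ schattenNorm p (tensorCLM A) = ∏ j, schattenNorm p (A j) := by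
  obtain ⟨h1, h2⟩ := schattenSum_tensorCLM (fun j => (hA j).1) p hp
  have h3 : schattenSum p (tensorCLM A) < ∞ := by
    rw [h1]
    exact ENNReal.prod_lt_top fun j _ => (hA j).2
  refine ⟨⟨h2 h3, h3⟩, ?_⟩
  simp only [schattenNorm]
  rw [h1, ENNReal.toReal_prod, Real.finsetProd_rpow _ _ fun _ _ => ENNReal.toReal_nonneg]

/-- Basis independence permits computing the left side in the product of the bases that define each
`trace (A j)`, where the diagonal entries factor. -/
lemma trace_tensorCLM {A : ∀ j, H j →L[ℂ] H j} (hA : ∀ j, MemSchatten 1 (A j)) :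
    trace (tensorCLM A) = ∏ j, trace (A j) := by
  obtain ⟨B, hB⟩ := exists_hilbertBasis_elemTensor
    fun j => (exists_hilbertBasis ℂ (H j)).choose_spec.choose
  have h1 := hasTrace_trace (memSchatten_tensorCLM one_pos hA).1 _ B
  have h2 := hasSum_pi_prod fun j => hasTrace_trace (hA j) _
    (exists_hilbertBasis ℂ (H j)).choose_spec.choose
  refine h1.unique (h2.congr_fun fun k => ?_)
  rw [hB, tensorCLM_elemTensor, inner_elemTensor]

end Main

end HilbertTensor

end

theorem mainTheorem7 {n : ℕ} (H : Fin n → Type*)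
    [∀ j, NormedAddCommGroup (H j)] [∀ j, InnerProductSpace ℂ (H j)]
    [∀ j, CompleteSpace (H j)] [∀ j, TopologicalSpace.SeparableSpace (H j)]
    (A : ∀ j, H j →L[ℂ] H j) :
    ∃ T : HilbertTensor.HilbertTensorProduct H →L[ℂ] HilbertTensor.HilbertTensorProduct H,
      HilbertTensor.tensorOp A = T.toLinearMap.toPMap ⊤ ∧
      ‖T‖ = ∏ j, ‖A j‖ ∧
      (∀ p : ℝ, 0 < p → (∀ j, HilbertTensor.MemSchatten p (A j)) →
        HilbertTensor.MemSchatten p T ∧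
        HilbertTensor.schattenNorm p T = ∏ j, HilbertTensor.schattenNorm p (A j)) ∧
      ((∀ j, HilbertTensor.MemSchatten 1 (A j)) →
        (∀ j, HilbertTensor.HasTrace (A j) (HilbertTensor.trace (A j))) ∧
        HilbertTensor.HasTrace T (HilbertTensor.trace T) ∧
        HilbertTensor.trace T = ∏ j, HilbertTensor.trace (A j)) :=
  ⟨HilbertTensor.tensorCLM A, HilbertTensor.tensorOp_eq_tensorCLM A,
    HilbertTensor.norm_tensorCLM A, fun _ hp hA => HilbertTensor.memSchatten_tensorCLM hp hA,
    fun hA => ⟨fun j => HilbertTensor.hasTrace_trace (hA j),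
      HilbertTensor.hasTrace_trace (HilbertTensor.memSchatten_tensorCLM one_pos hA).1,
      HilbertTensor.trace_tensorCLM hA⟩⟩
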